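/- Let $G=(V,E)$ be a finite simple graph on $N=|V|$ vertices, each vertex carrying a qubit, and let $|G\rangle=\prod_{\{i,j\}\in E}\mathrm{CZ}^{\{i,j\}}\,|+\rangle^{\otimes N}$ be its graph state, where $|+\rangle=(|0\rangle+|1\rangle)/\sqrt2$ and $\mathrm{CZ}^{\{i,j\}}=|0\rangle_i\langle 0|\otimes\mathbb I_j+|1\rangle_i\langle 1|\otimes Z_j$. Let $\mathcal P=\{A_1,\dots,A_m\}$, $m\ge 2$, be a partition of $V$ into nonempty disjoint sets. A bipartition $\{A,\bar A\}$ of $\mathcal P$ consists of a set $A$ that is a union of some of the $A_i$ and its complement $\bar A=V\setminus A$, both nonempty. A pure (unit-vector) state is $\mathcal P$-fully separable if it has the form $\bigotimes_{i=1}^m|\Phi_{A_i}\rangle$ with pure states $|\Phi_{A_i}\rangle$ of the qubits in $A_i$, and $\mathcal P$-bi-separable if it has the form $|\Phi_A\rangle\otimes|\Phi_{\bar A}\rangle$ for some bipartition $\{A,\bar A\}$ of $\mathcal P$. A mixed state is $\mathcal P$-fully separable (respectively $\mathcal P$-bi-separable) if it is a finite convex mixture $\sum_k p_k|\Psi_k\rangle\langle\Psi_k|$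 of $\mathcal P$-fully separable (respectively $\mathcal P$-bi-separable) pure states; in the bi-separable case the bipartition may depend on $k$. For $A\subseteq V$ let $\rho_A=\mathrm{Tr}_{\bar A}(|G\rangle\langle G|)$ be the reduced density matrix and $S(\rho_A)=-\mathrm{Tr}[\rho_A\log_2\rho_A]$ its von Neumann entropy. Then every $\mathcal P$-fully separable state $\rho_f$ satisfies $$\mathrm{Tr}\left(|G\rangle\langle G|\,\rho_f\right)\le\min_{\{A,\bar A\}}2^{-S(\rho_A)},$$ and every $\mathcal P$-bi-separable state $\rho_b$ satisfies $$\mathrm{Tr}\left(|G\rangle\langle G|\,\rho_b\right)\le\max_{\{A,\bar A\}}2^{-S(\rho_A)},$$ where the minimum and the maximum run over all bipartitions $\{A,\bar A\}$ of $\mathcal P$. -/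

import Mathlib

open scoped ComplexOrder

noncomputable section

namespace GraphStateFidelity

/-- The Hilbert space of a system of qubits labelled by `S`: the tensor product of copies of `ℂ²`,
with orthonormal computational basis the bit strings `S → Fin 2`. -/
abbrev Ket (S : Type*) [Fintype S] [DecidableEq S] : Type _ := EuclideanSpace ℂ (S → Fin 2)

/-- Operators on the qubits labelled by `S`, as matrices in the computational basis. -/
abbrev Op (S : Type*) : Type _ := Matrix (S → Fin 2) (S → Fin 2) ℂ

section Systems

variable {V : Type*} [Fintype V] [DecidableEq V]

/-- The rank-one operator `|ψ⟩⟨ψ|`. -/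
def ketBra (ψ : Ket V) : Op V := Matrix.of fun x y => ψ x * star (ψ y)

/-- Restriction of a bit string to the qubits in `A`. -/
def restr (A : Finset V) (x : V → Fin 2) : A → Fin 2 := fun v => x v

/-- The bit string on all qubits that is `x` on `A` and `z` on the complement of `A`. -/
def glue (A : Finset V) (x : A → Fin 2) (z : (Aᶜ : Finset V) → Fin 2) : V → Fin 2 :=
  fun v => if h : v ∈ A then x ⟨v, h⟩ else z ⟨v, Finset.mem_compl.mpr h⟩

/-- The partial trace over the complement of `A`. -/
def partialTrace (A : Finset V) (ρ : Op V) : Op A :=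
  Matrix.of fun x y => ∑ z : (Aᶜ : Finset V) → Fin 2, ρ (glue A x z) (glue A y z)

/-- The von Neumann entropy `S(ρ) = -Tr[ρ log₂ ρ]`, in bits. The logarithm of the Hermitian matrix
`ρ` is taken through the functional calculus; since `Real.logb 2 0 = 0`, a zero eigenvalue
contributes `0`. -/
def vonNeumannEntropy (ρ : Op V) : ℝ :=
  -(Matrix.trace (ρ * cfc (Real.logb 2) ρ)).re

/-! ### Graph states -/

/-- The one-qubit state `|+⟩ = (|0⟩ + |1⟩) / √2`. -/
def ketPlus : EuclideanSpace ℂ (Fin 2) := !₂[1 / (Real.sqrt 2 : ℂ), 1 / (Real.sqrt 2 : ℂ)]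

/-- The product state `|+⟩ ⊗ ⋯ ⊗ |+⟩`. -/
def plusState (V : Type*) [Fintype V] [DecidableEq V] : Ket V :=
  WithLp.toLp 2 fun x => ∏ v, ketPlus (x v)

/-- The one-qubit operator `M` acting on qubit `i`, with identities on all other qubits. -/
def onQubit (i : V) (M : Matrix (Fin 2) (Fin 2) ℂ) : Op V :=
  Matrix.of fun x y => if ∀ k, k ≠ i → x k = y k then M (x i) (y i) else 0

/-- The controlled-`Z` gate `|0⟩⟨0|ᵢ ⊗ 𝕀ⱼ + |1⟩⟨1|ᵢ ⊗ Zⱼ`. -/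
def CZ (i j : V) : Op V :=
  onQubit i !![1, 0; 0, 0] + onQubit i !![0, 0; 0, 1] * onQubit j !![1, 0; 0, -1]

lemma onQubit_diagonal (i : V) (a b : ℂ) :
    onQubit i !![a, 0; 0, b] = Matrix.diagonal fun x => if x i = 1 then b else a := by
  ext x y
  by_cases hxy : x = y
  · subst hxy
    have : x i = 0 ∨ x i = 1 := by generalize x i = t; fin_cases t <;> simp
    rcases this with h | h <;> simp [onQubit, h]
  · rw [Matrix.diagonal_apply_ne _ hxy]
    simp only [onQubit, Matrix.of_apply]
    split_ifs with h
    · have hi : x i ≠ y i := fun hi => hxy (funext fun k => by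
        by_cases hk : k = i
        · rw [hk, hi]
        · exact h k hk)
      revert hi
      generalize x i = s
      generalize y i = t
      fin_cases s <;> fin_cases t <;> simp
    · rfl

lemma CZ_eq_diagonal (i j : V) :
    CZ i j = Matrix.diagonal fun x => if x i = 1 ∧ x j = 1 then -1 else 1 := by
  rw [CZ, onQubit_diagonal, onQubit_diagonal, onQubit_diagonal, Matrix.diagonal_mul_diagonal,
    Matrix.diagonal_add]
  congr 1
  ext x
  by_cases h : x i = 1 <;> by_cases h' : x j = 1 <;> simp [h, h']

lemma CZ_comm (i j : V) : CZ i j = CZ j i := by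
  simp only [CZ_eq_diagonal, and_comm]

/-- The controlled-`Z` gate of an (unordered) edge. -/
def edgeCZ (e : Sym2 V) : Op V := Sym2.lift ⟨CZ, CZ_comm⟩ e

lemma edgeCZ_commute (e f : Sym2 V) : Commute (edgeCZ e) (edgeCZ f) := by
  induction e using Sym2.ind with | _ i j =>
  induction f using Sym2.ind with | _ k l =>
  simp only [edgeCZ, Sym2.lift_mk, CZ_eq_diagonal]
  exact Matrix.commute_diagonal _ _

lemma edgeCZ_pairwise_commute (s : Set (Sym2 V)) :
    s.Pairwise (Function.onFun Commute edgeCZ) :=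
  fun e _ f _ _ => edgeCZ_commute e f

/-- The graph state `|G⟩ = ∏_{(i,j) ∈ E} CZ^{i,j} |+⟩^{⊗N}` (the gates commute, so that the order
of the product is irrelevant). -/
def graphState (G : SimpleGraph V) [DecidableRel G.Adj] : Ket V :=
  WithLp.toLp 2 ((G.edgeFinset.noncommProd edgeCZ (edgeCZ_pairwise_commute _)).mulVec
    (plusState V).ofLp)

/-- The reduced density matrix `ρ_A = Tr_{Aᶜ} |G⟩⟨G|` of a graph state. -/
def reducedState (G : SimpleGraph V) [DecidableRel G.Adj] (A : Finset V) : Op A :=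
  partialTrace A (ketBra (graphState G))

/-! ### Separability with respect to a partition -/

/-- The sets `A` that occur in the bipartitions `{A, Aᶜ}` of the partition `P`: unions of blocks of
`P`, with `A` and `Aᶜ` nonempty. Each bipartition occurs twice, as `A` and as `Aᶜ`. -/
def bipartitions (P : Finpartition (Finset.univ : Finset V)) : Finset (Finset V) :=
  (P.parts.powerset.image fun Q => Q.sup id).filter fun A => A.Nonempty ∧ Aᶜ.Nonempty

lemma bipartitions_nonempty (P : Finpartition (Finset.univ : Finset V))
    (hP : 2 ≤ P.parts.card) : (bipartitions P).Nonempty := by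
  obtain ⟨A, hA, B, hB, hAB⟩ := Finset.one_lt_card.mp hP
  refine ⟨A, ?_⟩
  simp only [bipartitions, Finset.mem_filter, Finset.mem_image, Finset.mem_powerset]
  refine ⟨⟨{A}, by simpa using hA, by simp⟩, P.nonempty_of_mem_parts hA, ?_⟩
  obtain ⟨v, hv⟩ := P.nonempty_of_mem_parts hB
  exact ⟨v, Finset.mem_compl.mpr (Finset.disjoint_right.mp (P.disjoint hA hB hAB) hv)⟩

/-- A pure state is `P`-fully separable if it is a tensor product of pure states of the blocks. -/
def IsFullySeparablePure (P : Finpartition (Finset.univ : Finset V)) (ψ : Ket V) : Prop :=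
  ∃ Φ : (A : Finset V) → Ket A, (∀ A ∈ P.parts, ‖Φ A‖ = 1) ∧
    ∀ x, ψ x = ∏ A ∈ P.parts, Φ A (restr A x)

/-- A pure state is `P`-bi-separable if it is a tensor product of pure states of the two sides of
some bipartition of `P`. -/
def IsBiSeparablePure (P : Finpartition (Finset.univ : Finset V)) (ψ : Ket V) : Prop :=
  ∃ A ∈ bipartitions P, ∃ (Φ : Ket A) (Φ' : Ket (Aᶜ : Finset V)), ‖Φ‖ = 1 ∧ ‖Φ'‖ = 1 ∧
    ∀ x, ψ x = Φ (restr A x) * Φ' (restr Aᶜ x)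

/-- `ρ` is a convex mixture of pure states with the property `p`. -/
def IsMixtureOf (p : Ket V → Prop) (ρ : Op V) : Prop :=
  ∃ (n : ℕ) (w : Fin n → ℝ) (ψ : Fin n → Ket V), (∀ i, 0 ≤ w i) ∧ ∑ i, w i = 1 ∧
    (∀ i, p (ψ i)) ∧ ρ = ∑ i, (w i : ℂ) • ketBra (ψ i)

/-- `P`-fully separable (mixed) states. -/
def IsFullySeparable (P : Finpartition (Finset.univ : Finset V)) (ρ : Op V) : Prop :=
  IsMixtureOf (IsFullySeparablePure P) ρ

/-- `P`-bi-separable (mixed) states; different terms of the mixture may be separable with respect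
to different bipartitions. -/
def IsBiSeparable (P : Finpartition (Finset.univ : Finset V)) (ρ : Op V) : Prop :=
  IsMixtureOf (IsBiSeparablePure P) ρ

end Systems

end GraphStateFidelity

end

/-!
The amplitudes of a graph state are, up to the factor `2^(-N/2)`, signs `(-1)^q(x)` with `q` a
quadratic form over `𝔽₂`. Splitting `x` into its parts on `A` and on the complement, the only sign
that couples the two is the polarisation of `q`, a bicharacter (`crossSign`). The entries of the
reduced state `ρ_A` are therefore, up to signs that factorise, character sums `crossSum (x + y)`,
which vanish unless the character is trivial. Hence `ρ_A` is flat: `ρ_A² = c ρ_A` with a `c > 0`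
(`reducedState_mul_self`). Together with `Tr ρ_A = 1` this says that all nonzero eigenvalues of `ρ_A`
are equal to `c`, so that the entropy is `-log₂ c` and `2^(-S(ρ_A)) = c` is the largest eigenvalue.

For a product vector `Φ ⊗ Φ'` across `A` and its complement, the Cauchy-Schwarz inequality on the
complement gives `|⟨G|Φ ⊗ Φ'⟩|² ≤ ⟨Φ|ρ_A|Φ⟩ ‖Φ'‖² ≤ c ‖Φ‖² ‖Φ'‖²` (`norm_inner_sq_le`). A
bi-separable pure state is such a product for some bipartition, which gives the maximum, and a
fully separable one is such a product for every bipartition, which gives the minimum. Convex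
mixtures preserve both bounds.
-/

noncomputable section

namespace GraphStateFidelity

/-! ### Gluing bit strings -/

section Gluing

variable {V : Type*} [Fintype V] [DecidableEq V] (A : Finset V)

lemma restr_glue (x : A → Fin 2) (z : (Aᶜ : Finset V) → Fin 2) : restr A (glue A x z) = x := by
  funext v
  simp [restr, glue]

lemma restr_compl_glue (x : A → Fin 2) (z : (Aᶜ : Finset V) → Fin 2) :
    restr Aᶜ (glue A x z) = z := by
  funext v
  have := Finset.mem_compl.mp v.2
  simp [restr, glue, this]

lemma glue_restr (x : V → Fin 2) : glue A (restr A x) (restr Aᶜ x) = x := by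
  funext v
  simp [restr, glue]

/-- Bit strings on all qubits as pairs of bit strings on `A` and on its complement. -/
def glueEquiv : (A → Fin 2) × ((Aᶜ : Finset V) → Fin 2) ≃ (V → Fin 2) where
  toFun p := glue A p.1 p.2
  invFun x := (restr A x, restr Aᶜ x)
  left_inv p := by simp [restr_glue, restr_compl_glue]
  right_inv x := glue_restr A x

lemma sum_glue {M : Type*} [AddCommMonoid M] (f : (V → Fin 2) → M) :
    ∑ x, ∑ z, f (glue A x z) = ∑ x, f x := by
  rw [← Fintype.sum_prod_type' (f := fun x z => f (glue A x z))]
  exact (glueEquiv A).sum_comp f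

lemma glue_add (x x' : A → Fin 2) (z z' : (Aᶜ : Finset V) → Fin 2) :
    glue A (x + x') (z + z') = glue A x z + glue A x' z' := by
  funext v
  by_cases h : v ∈ A <;> simp [glue, h]

end Gluing

/-! ### The sign function of a graph state -/

section Sign

variable {V : Type*} [Fintype V] [DecidableEq V]

/-- The sign `(-1)^(xᵢ xⱼ)` that the controlled-`Z` gate of the edge `{i, j}` gives to the basis
state `x`. -/
def edgeSign (e : Sym2 V) (x : V → Fin 2) : ℤ :=
  Sym2.lift ⟨fun i j => if x i = 1 ∧ x j = 1 then -1 else 1,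
    fun i j => by simp only [and_comm]⟩ e

/-- The sign of the amplitude of the basis state `x` in the graph state, `(-1)` to the number of
edges with both ends in the support of `x`. -/
def graphSign (G : SimpleGraph V) [DecidableRel G.Adj] (x : V → Fin 2) : ℤ :=
  ∏ e ∈ G.edgeFinset, edgeSign e x

lemma edgeCZ_eq_diagonal (e : Sym2 V) :
    edgeCZ e = Matrix.diagonal fun x => (edgeSign e x : ℂ) := by
  induction e using Sym2.ind with | _ i j =>
  simp only [edgeCZ, edgeSign, Sym2.lift_mk, CZ_eq_diagonal]
  congr 1
  funext x
  split_ifs <;> simp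

lemma noncommProd_edgeCZ (s : Finset (Sym2 V)) :
    s.noncommProd edgeCZ (edgeCZ_pairwise_commute _) =
      Matrix.diagonal fun x => ((∏ e ∈ s, edgeSign e x : ℤ) : ℂ) := by
  induction s using Finset.induction_on with
  | empty => simp
  | insert e s he ih =>
    rw [Finset.noncommProd_insert_of_notMem _ _ _ _ he, ih, edgeCZ_eq_diagonal,
      Matrix.diagonal_mul_diagonal]
    congr 1
    funext x
    rw [Finset.prod_insert he]
    push_cast
    rfl

variable (G : SimpleGraph V) [DecidableRel G.Adj]

lemma graphState_apply (x : V → Fin 2) :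
    graphState G x = (graphSign G x : ℂ) * (1 / (Real.sqrt 2 : ℂ)) ^ Fintype.card V := by
  have hp : ∀ t : Fin 2, ketPlus t = 1 / (Real.sqrt 2 : ℂ) := by
    intro t
    fin_cases t <;> simp [ketPlus]
  simp [graphState, noncommProd_edgeCZ, Matrix.mulVec_diagonal, graphSign, plusState, hp]

lemma graphSign_mul_self (x : V → Fin 2) : graphSign G x * graphSign G x = 1 := by
  rw [graphSign, ← Finset.prod_mul_distrib]
  refine Finset.prod_eq_one fun e _ => ?_
  induction e using Sym2.ind with | _ i j =>
  simp only [edgeSign, Sym2.lift_mk]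
  split_ifs <;> simp

@[simp] lemma graphSign_zero : graphSign G 0 = 1 := by
  refine Finset.prod_eq_one fun e _ => ?_
  induction e using Sym2.ind with | _ i j =>
  simp [edgeSign]

/-- The sign is the exponential of a quadratic form over `𝔽₂`: its third difference vanishes. -/
lemma graphSign_add_add (x y z : V → Fin 2) :
    graphSign G (x + y + z) * graphSign G x * graphSign G y * graphSign G z =
      graphSign G (x + y) * graphSign G (x + z) * graphSign G (y + z) := by
  simp only [graphSign, ← Finset.prod_mul_distrib]
  refine Finset.prod_congr rfl fun e _ => ?_
  induction e using Sym2.ind with | _ i j =>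
  simp only [edgeSign, Sym2.lift_mk, Pi.add_apply]
  have key : ∀ a b c d e f : Fin 2,
      (if a + c + e = 1 ∧ b + d + f = 1 then (-1 : ℤ) else 1) * (if a = 1 ∧ b = 1 then -1 else 1) *
        (if c = 1 ∧ d = 1 then -1 else 1) * (if e = 1 ∧ f = 1 then -1 else 1) =
      (if a + c = 1 ∧ b + d = 1 then -1 else 1) * (if a + e = 1 ∧ b + f = 1 then -1 else 1) *
        (if c + e = 1 ∧ d + f = 1 then -1 else 1) := by decide
  exact key _ _ _ _ _ _

variable (A : Finset V)

/-- The sign contributed by the edges between `A` and its complement: the polarisation of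
`graphSign`, evaluated at a bit string on `A` and one on the complement. -/
def crossSign (x : A → Fin 2) (z : (Aᶜ : Finset V) → Fin 2) : ℤ :=
  graphSign G (glue A x z) * graphSign G (glue A x 0) * graphSign G (glue A 0 z)

lemma graphSign_glue (x : A → Fin 2) (z : (Aᶜ : Finset V) → Fin 2) :
    graphSign G (glue A x z) =
      graphSign G (glue A x 0) * graphSign G (glue A 0 z) * crossSign G A x z := by
  have h1 := graphSign_mul_self G (glue A x 0)
  have h2 := graphSign_mul_self G (glue A 0 z)
  rw [crossSign]
  linear_combination (-graphSign G (glue A x z)) * h2 -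
    graphSign G (glue A x z) * graphSign G (glue A 0 z) ^ 2 * h1

lemma crossSign_add_left (x y : A → Fin 2) (z : (Aᶜ : Finset V) → Fin 2) :
    crossSign G A (x + y) z = crossSign G A x z * crossSign G A y z := by
  have h := graphSign_add_add G (glue A x 0) (glue A y 0) (glue A 0 z)
  simp only [← glue_add, add_zero, zero_add] at h
  have h1 := graphSign_mul_self G (glue A x 0)
  have h2 := graphSign_mul_self G (glue A y 0)
  have h3 := graphSign_mul_self G (glue A 0 z)
  have h4 := graphSign_mul_self G (glue A (x + y) 0)
  simp only [crossSign]
  set a := graphSign G (glue A x 0)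
  set b := graphSign G (glue A y 0)
  set c := graphSign G (glue A 0 z)
  set d := graphSign G (glue A (x + y) 0)
  set p := graphSign G (glue A (x + y) z)
  set q := graphSign G (glue A x z)
  set r := graphSign G (glue A y z)
  have e1 : p * d * c = (p * a * b * c) * (a * b * d) := by
    linear_combination (-(p * d * c)) * h1 - (p * d * c * a ^ 2) * h2
  rw [e1, h]
  linear_combination (q * r * a * b) * h4 - (q * r * a * b) * h3

lemma crossSign_add_right (x : A → Fin 2) (z w : (Aᶜ : Finset V) → Fin 2) :
    crossSign G A x (z + w) = crossSign G A x z * crossSign G A x w := by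
  have h := graphSign_add_add G (glue A x 0) (glue A 0 z) (glue A 0 w)
  simp only [← glue_add, add_zero, zero_add] at h
  have h1 := graphSign_mul_self G (glue A x 0)
  have h2 := graphSign_mul_self G (glue A 0 z)
  have h3 := graphSign_mul_self G (glue A 0 w)
  have h4 := graphSign_mul_self G (glue A 0 (z + w))
  simp only [crossSign]
  set a := graphSign G (glue A x 0)
  set b := graphSign G (glue A 0 z)
  set c := graphSign G (glue A 0 w)
  set d := graphSign G (glue A 0 (z + w))
  set p := graphSign G (glue A x (z + w))
  set q := graphSign G (glue A x z)
  set r := graphSign G (glue A x w)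
  have e1 : p * a * d = (p * a * b * c) * (b * c * d) := by
    linear_combination (-(p * a * d)) * h2 - (p * a * d * b ^ 2) * h3
  rw [e1, h]
  linear_combination (q * r * b * c) * h4 - (q * r * b * c) * h1

lemma crossSign_zero_left (z : (Aᶜ : Finset V) → Fin 2) : crossSign G A 0 z = 1 := by
  have h : glue A (0 : A → Fin 2) 0 = 0 := by
    funext v
    simp [glue]
  simp [crossSign, h, graphSign_mul_self]

/-- The character sum `∑_z crossSign u z`, which is up to normalisation and signs the entry of
the reduced state at `x, y` with `x + y = u`. -/
def crossSum (u : A → Fin 2) : ℤ := ∑ z, crossSign G A u z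

lemma crossSum_zero : crossSum G A 0 = Fintype.card ((Aᶜ : Finset V) → Fin 2) := by
  simp [crossSum, crossSign_zero_left]

/-- A character with nonzero sum is trivial, so translating by `w` does not change `crossSum`
if `crossSum w ≠ 0`. -/
lemma crossSum_mul_crossSum_add (w t : A → Fin 2) :
    crossSum G A w * crossSum G A (w + t) = crossSum G A w * crossSum G A t := by
  have key : ∀ z, crossSign G A w z * crossSum G A w = crossSum G A w := by
    intro z
    rw [crossSum, Finset.mul_sum]
    simp only [← crossSign_add_right]
    exact Equiv.sum_comp (Equiv.addLeft z) (crossSign G A w)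
  conv_lhs => rw [crossSum.eq_def G A (w + t), Finset.mul_sum]
  conv_rhs => rw [crossSum.eq_def G A t, Finset.mul_sum]
  refine Finset.sum_congr rfl fun z _ => ?_
  rw [crossSign_add_left]
  linear_combination crossSign G A t z * key z

lemma crossSum_nonneg (w : A → Fin 2) : 0 ≤ crossSum G A w := by
  have h := crossSum_mul_crossSum_add G A w 0
  rw [add_zero, crossSum_zero] at h
  have hc : (0 : ℤ) < Fintype.card ((Aᶜ : Finset V) → Fin 2) := by
    exact_mod_cast Fintype.card_pos
  nlinarith [mul_self_nonneg (crossSum G A w)]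

lemma sum_crossSum_pos : 0 < ∑ w, crossSum G A w := by
  refine Finset.sum_pos' (fun w _ => crossSum_nonneg G A w) ⟨0, Finset.mem_univ _, ?_⟩
  rw [crossSum_zero]
  exact_mod_cast Fintype.card_pos

end Sign

/-! ### The reduced states of a graph state are flat -/

section Reduced

variable {V : Type*} [Fintype V] [DecidableEq V] (G : SimpleGraph V) [DecidableRel G.Adj]
  (A : Finset V)

/-- The common value of all nonzero eigenvalues of the reduced state of a graph state on `A`. -/
def flatEigenvalue : ℝ := (2 ^ Fintype.card V)⁻¹ * ((∑ w, crossSum G A w : ℤ) : ℝ)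

lemma flatEigenvalue_pos : 0 < flatEigenvalue G A := by
  have : (0 : ℝ) < ((∑ w, crossSum G A w : ℤ) : ℝ) := by exact_mod_cast sum_crossSum_pos G A
  unfold flatEigenvalue
  positivity

lemma graphState_mul_star (x y : V → Fin 2) :
    graphState G x * star (graphState G y) =
      (2 ^ Fintype.card V)⁻¹ * ((graphSign G x * graphSign G y : ℤ) : ℂ) := by
  have h : (1 / (Real.sqrt 2 : ℂ)) * (1 / (Real.sqrt 2 : ℂ)) = 2⁻¹ := by
    rw [one_div, ← mul_inv, ← Complex.ofReal_mul, Real.mul_self_sqrt (by norm_num)]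
    norm_num
  have h' : (1 / (Real.sqrt 2 : ℂ)) ^ Fintype.card V * (1 / (Real.sqrt 2 : ℂ)) ^ Fintype.card V =
      (2 ^ Fintype.card V)⁻¹ := by
    rw [← mul_pow, h, inv_pow]
  have hs : star (graphState G y) = graphState G y := by
    rw [graphState_apply]
    simp
  rw [hs, graphState_apply, graphState_apply]
  push_cast
  linear_combination (graphSign G x : ℂ) * graphSign G y * h'

lemma reducedState_apply (x y : A → Fin 2) :
    reducedState G A x y = (2 ^ Fintype.card V)⁻¹ *
      ((graphSign G (glue A x 0) * graphSign G (glue A y 0) * crossSum G A (x + y) : ℤ) : ℂ) := by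
  simp only [reducedState, partialTrace, ketBra, Matrix.of_apply, graphState_mul_star]
  rw [← Finset.mul_sum, ← Int.cast_sum, crossSum, Finset.mul_sum]
  congr 2
  refine Finset.sum_congr rfl fun z _ => ?_
  rw [graphSign_glue G A x z, graphSign_glue G A y z, crossSign_add_left]
  linear_combination (graphSign G (glue A x 0) * graphSign G (glue A y 0) *
    crossSign G A x z * crossSign G A y z) * graphSign_mul_self G (glue A 0 z)

lemma reducedState_isHermitian : (reducedState G A).IsHermitian := by
  ext x y
  rw [Matrix.conjTranspose_apply, reducedState_apply, reducedState_apply, add_comm y x]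
  simp only [star_mul', star_inv₀, star_pow, star_ofNat, star_intCast]
  push_cast
  ring

lemma reducedState_trace : (reducedState G A).trace = 1 := by
  have h : ∀ x, reducedState G A x x =
      (2 ^ Fintype.card V)⁻¹ * (Fintype.card ((Aᶜ : Finset V) → Fin 2) : ℂ) := by
    intro x
    have hx : x + x = 0 := by
      funext v
      change x v + x v = 0
      generalize x v = t
      revert t
      decide
    rw [reducedState_apply, graphSign_mul_self, hx, crossSum_zero]
    simp
  have hc : Fintype.card (A → Fin 2) * Fintype.card ((Aᶜ : Finset V) → Fin 2) =
      2 ^ Fintype.card V := by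
    rw [← Fintype.card_prod, Fintype.card_congr (glueEquiv A)]
    simp
  have hc' : (Fintype.card (A → Fin 2) : ℂ) * Fintype.card ((Aᶜ : Finset V) → Fin 2) =
      2 ^ Fintype.card V := by exact_mod_cast hc
  simp only [Matrix.trace, Matrix.diag_apply, h, Finset.sum_const, Finset.card_univ,
    nsmul_eq_mul]
  rw [mul_left_comm, hc', inv_mul_cancel₀ (by positivity)]

/-- The reduced state is proportional to a projection. The signs cancel in the product, and the
sum over the intermediate index is a self-convolution of `crossSum`. -/
lemma reducedState_mul_self :
    reducedState G A * reducedState G A = (flatEigenvalue G A : ℂ) • reducedState G A := by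
  ext x y
  have key : ∑ w, graphSign G (glue A x 0) * graphSign G (glue A w 0) * crossSum G A (x + w) *
      (graphSign G (glue A w 0) * graphSign G (glue A y 0) * crossSum G A (w + y)) =
      (∑ w, crossSum G A w) *
        (graphSign G (glue A x 0) * graphSign G (glue A y 0) * crossSum G A (x + y)) := by
    rw [← Equiv.sum_comp (Equiv.addLeft x) (crossSum G A), Finset.sum_mul]
    refine Finset.sum_congr rfl fun w _ => ?_
    -- In characteristic two `(x + w) + (x + y) = w + y`.
    have h := crossSum_mul_crossSum_add G A (x + w) (x + y)
    have e : x + w + (x + y) = w + y := by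
      funext v
      change x v + w v + (x v + y v) = w v + y v
      generalize x v = a
      generalize y v = b
      generalize w v = c
      revert a b c
      decide
    rw [e] at h
    rw [Equiv.coe_addLeft]
    linear_combination (graphSign G (glue A x 0) * graphSign G (glue A y 0)) * h +
      (graphSign G (glue A x 0) * graphSign G (glue A y 0) * crossSum G A (x + w) *
        crossSum G A (w + y)) * graphSign_mul_self G (glue A w 0)
  have key' := congrArg (Int.cast : ℤ → ℂ) key
  simp only [Matrix.mul_apply, Matrix.smul_apply, reducedState_apply, flatEigenvalue, smul_eq_mul]
  push_cast at key' ⊢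
  have e : ∀ a b c : ℂ, c * a * (c * b) = c * c * (a * b) := fun a b c => by ring
  simp only [e]
  rw [← Finset.mul_sum, key']

end Reduced

/-! ### Entropy and expectation values of flat states -/

section Flat

variable {S : Type*} [Fintype S] [DecidableEq S] {ρ : Op S} {c : ℝ}

/-- On the spectrum, which is contained in `{0, c}`, the functions `t log₂ t` and `t log₂ c`
agree. -/
lemma vonNeumannEntropy_of_mul_self (hρ : ρ.IsHermitian) (h : ρ * ρ = (c : ℂ) • ρ)
    (ht : ρ.trace = 1) : vonNeumannEntropy ρ = -Real.logb 2 c := by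
  have hsa : IsSelfAdjoint ρ := hρ
  have hcont : ∀ f : ℝ → ℝ, ContinuousOn f (spectrum ℝ ρ) := fun f =>
    (Matrix.finite_real_spectrum).continuousOn f
  have hspec : ∀ μ ∈ spectrum ℝ ρ, μ * μ = c * μ := by
    intro μ hμ
    have h0 : cfc (fun t : ℝ => t * t - c * t) ρ = 0 := by
      rw [cfc_sub (hf := hcont _) (hg := hcont _), cfc_mul (hf := hcont _) (hg := hcont _),
        cfc_const_mul c (fun t : ℝ => t) ρ (hcont _), cfc_id' ℝ ρ, h]
      ext i j
      simp
    have := cfc_map_spectrum (fun t : ℝ => t * t - c * t) ρ hsa (hcont _)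
    have hm : μ * μ - c * μ ∈ spectrum ℝ (cfc (fun t : ℝ => t * t - c * t) ρ) :=
      this ▸ Set.mem_image_of_mem (fun t : ℝ => t * t - c * t) hμ
    rw [h0] at hm
    by_contra hne
    have : IsUnit (algebraMap ℝ (Op S) (μ * μ - c * μ) - 0) := by
      rw [sub_zero]
      exact (IsUnit.mk0 _ (sub_ne_zero.mpr hne)).map _
    exact hm this
  have hmul : ρ * cfc (Real.logb 2) ρ = Real.logb 2 c • ρ := by
    calc ρ * cfc (Real.logb 2) ρ
        = cfc (fun t : ℝ => t) ρ * cfc (Real.logb 2) ρ := by rw [cfc_id' ℝ ρ]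
      _ = cfc (fun t : ℝ => t * Real.logb 2 t) ρ :=
          (cfc_mul (fun t : ℝ => t) (Real.logb 2) ρ (hcont _) (hcont _)).symm
      _ = cfc (fun t : ℝ => Real.logb 2 c * t) ρ := by
          refine cfc_congr fun t ht => ?_
          rcases eq_or_ne t 0 with rfl | h0
          · simp
          · rw [mul_right_cancel₀ h0 (hspec t ht)]
            exact mul_comm _ _
      _ = Real.logb 2 c • ρ := by
          rw [cfc_const_mul _ (fun t : ℝ => t) ρ (hcont _), cfc_id' ℝ ρ]
  rw [vonNeumannEntropy, hmul, Matrix.trace_smul, ht]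
  simp

lemma two_rpow_neg_vonNeumannEntropy (hρ : ρ.IsHermitian) (h : ρ * ρ = (c : ℂ) • ρ)
    (ht : ρ.trace = 1) (hc : 0 < c) : (2 : ℝ) ^ (-vonNeumannEntropy ρ) = c := by
  rw [vonNeumannEntropy_of_mul_self hρ h ht, neg_neg,
    Real.rpow_logb (by norm_num) (by norm_num) hc]

open scoped Matrix in
lemma dotProduct_mulVec_le_of_mul_self (hρ : ρ.IsHermitian) (h : ρ * ρ = (c : ℂ) • ρ)
    (hc : 0 < c) (v : (S → Fin 2) → ℂ) : star v ⬝ᵥ (ρ *ᵥ v) ≤ (c : ℂ) * (star v ⬝ᵥ v) := by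
  -- `c - ρ` is positive, because `(c - ρ)² = c (c - ρ)`.
  have hsq : ((c : ℂ) • (1 : Op S) - ρ)ᴴ * ((c : ℂ) • (1 : Op S) - ρ) =
      (c : ℂ) • ((c : ℂ) • (1 : Op S) - ρ) := by
    have hstar : ((c : ℂ) • (1 : Op S) - ρ)ᴴ = (c : ℂ) • (1 : Op S) - ρ := by
      rw [Matrix.conjTranspose_sub, hρ.eq, Matrix.conjTranspose_smul, Matrix.conjTranspose_one]
      simp
    rw [hstar, Matrix.sub_mul, Matrix.mul_sub, Matrix.mul_sub, h, Matrix.mul_smul,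
      Matrix.smul_mul, Matrix.smul_mul, Matrix.mul_smul, Matrix.mul_one, Matrix.mul_one,
      Matrix.one_mul, sub_self, sub_zero, smul_sub]
  have hpos := (Matrix.posSemidef_conjTranspose_mul_self
    ((c : ℂ) • (1 : Op S) - ρ)).dotProduct_mulVec_nonneg v
  rw [hsq, Matrix.smul_mulVec, Matrix.sub_mulVec, Matrix.smul_mulVec, Matrix.one_mulVec,
    dotProduct_smul, dotProduct_sub, dotProduct_smul, smul_eq_mul, smul_eq_mul] at hpos
  have hc' : (0 : ℂ) < c := by exact_mod_cast hc
  exact sub_nonneg.mp (le_of_mul_le_mul_left (by rwa [mul_zero]) hc')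

end Flat

/-! ### Overlaps with product states -/

section Overlap

variable {V : Type*} [Fintype V] [DecidableEq V]

lemma norm_sq_of_eq_mul {A : Finset V} {ψ : Ket V} {Φ : Ket A} {Φ' : Ket (Aᶜ : Finset V)}
    (h : ∀ x, ψ x = Φ (restr A x) * Φ' (restr Aᶜ x)) : ‖ψ‖ ^ 2 = ‖Φ‖ ^ 2 * ‖Φ'‖ ^ 2 := by
  simp only [EuclideanSpace.norm_sq_eq]
  rw [← sum_glue A, Finset.sum_mul_sum]
  refine Finset.sum_congr rfl fun x _ => Finset.sum_congr rfl fun z _ => ?_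
  rw [h, restr_glue, restr_compl_glue, norm_mul, mul_pow]

/-- The partial inner product `⟨Φ|_A |χ⟩`, a vector of the qubits outside `A`. -/
def partialInner (A : Finset V) (Φ : Ket A) (χ : Ket V) : Ket (Aᶜ : Finset V) :=
  WithLp.toLp 2 fun z => ∑ x, star (Φ x) * χ (glue A x z)

lemma inner_eq_inner_partialInner {A : Finset V} (χ : Ket V) {ψ : Ket V} {Φ : Ket A}
    {Φ' : Ket (Aᶜ : Finset V)} (h : ∀ x, ψ x = Φ (restr A x) * Φ' (restr Aᶜ x)) :
    inner ℂ χ ψ = inner ℂ (partialInner A Φ χ) Φ' := by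
  simp only [PiLp.inner_apply, RCLike.inner_apply, partialInner]
  rw [← sum_glue A, Finset.sum_comm]
  refine Finset.sum_congr rfl fun z _ => ?_
  rw [map_sum, Finset.mul_sum]
  refine Finset.sum_congr rfl fun x _ => ?_
  rw [h, restr_glue, restr_compl_glue]
  simp
  ring

open scoped Matrix in
lemma norm_sq_partialInner (A : Finset V) (Φ : Ket A) (χ : Ket V) :
    ((‖partialInner A Φ χ‖ ^ 2 : ℝ) : ℂ) =
      star Φ.ofLp ⬝ᵥ (partialTrace A (ketBra χ) *ᵥ Φ.ofLp) := by
  rw [EuclideanSpace.norm_sq_eq]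
  push_cast
  simp only [← Complex.mul_conj', partialInner, map_sum, dotProduct,
    Matrix.mulVec, partialTrace, ketBra, Matrix.of_apply, Finset.mul_sum, Finset.sum_mul]
  rw [Finset.sum_comm]
  conv_rhs => rw [Finset.sum_comm]
  refine Finset.sum_congr rfl fun x _ => ?_
  rw [Finset.sum_comm]
  refine Finset.sum_congr rfl fun y _ => Finset.sum_congr rfl fun z _ => ?_
  simp
  ring

/-- If the reduced state of `χ` on `A` is flat with eigenvalue `c`, then `c` bounds the fidelity
of `χ` with any state that is a product across `A`. -/
lemma norm_inner_sq_le {A : Finset V} {χ ψ : Ket V} {c : ℝ}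
    (hρ : (partialTrace A (ketBra χ)).IsHermitian)
    (h : partialTrace A (ketBra χ) * partialTrace A (ketBra χ) =
      (c : ℂ) • partialTrace A (ketBra χ)) (hc : 0 < c) {Φ : Ket A} {Φ' : Ket (Aᶜ : Finset V)}
    (hψ : ∀ x, ψ x = Φ (restr A x) * Φ' (restr Aᶜ x)) :
    ‖(inner ℂ χ ψ : ℂ)‖ ^ 2 ≤ c * ‖ψ‖ ^ 2 := by
  have hΦ : star Φ.ofLp ⬝ᵥ Φ.ofLp = ((‖Φ‖ ^ 2 : ℝ) : ℂ) := by
    rw [EuclideanSpace.norm_sq_eq]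
    push_cast
    simp [dotProduct, Complex.conj_mul']
  have hT := dotProduct_mulVec_le_of_mul_self hρ h hc Φ.ofLp
  rw [← norm_sq_partialInner, hΦ] at hT
  have hT' : ‖partialInner A Φ χ‖ ^ 2 ≤ c * ‖Φ‖ ^ 2 := by exact_mod_cast hT
  rw [inner_eq_inner_partialInner χ hψ, norm_sq_of_eq_mul hψ, ← mul_assoc]
  calc ‖(inner ℂ (partialInner A Φ χ) Φ' : ℂ)‖ ^ 2
      ≤ (‖partialInner A Φ χ‖ * ‖Φ'‖) ^ 2 := by
        gcongr
        exact norm_inner_le_norm _ _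
    _ = ‖partialInner A Φ χ‖ ^ 2 * ‖Φ'‖ ^ 2 := mul_pow _ _ _
    _ ≤ c * ‖Φ‖ ^ 2 * ‖Φ'‖ ^ 2 := by gcongr

lemma trace_ketBra_mul_ketBra (χ ψ : Ket V) :
    (ketBra χ * ketBra ψ).trace = ((‖(inner ℂ χ ψ : ℂ)‖ ^ 2 : ℝ) : ℂ) := by
  push_cast
  rw [← Complex.conj_mul']
  simp only [PiLp.inner_apply, RCLike.inner_apply, map_sum, Finset.sum_mul_sum, Matrix.trace,
    Matrix.diag_apply, Matrix.mul_apply, ketBra, Matrix.of_apply]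
  refine Finset.sum_congr rfl fun x _ => Finset.sum_congr rfl fun y _ => ?_
  simp
  ring

lemma trace_ketBra_mul_le_of_isMixtureOf {p : Ket V → Prop} {χ : Ket V} {M : ℝ}
    (hp : ∀ ψ, p ψ → ‖(inner ℂ χ ψ : ℂ)‖ ^ 2 ≤ M) {ρ : Op V} (hρ : IsMixtureOf p ρ) :
    (ketBra χ * ρ).trace ≤ (M : ℂ) := by
  obtain ⟨n, w, ψ, hw, hsum, hψ, rfl⟩ := hρ
  have htr : (ketBra χ * ∑ i, (w i : ℂ) • ketBra (ψ i)).trace =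
      ((∑ i, w i * ‖(inner ℂ χ (ψ i) : ℂ)‖ ^ 2 : ℝ) : ℂ) := by
    simp only [Matrix.mul_sum, Matrix.mul_smul, Matrix.trace_sum, Matrix.trace_smul,
      trace_ketBra_mul_ketBra, smul_eq_mul]
    push_cast
    rfl
  rw [htr, Complex.real_le_real]
  calc ∑ i, w i * ‖(inner ℂ χ (ψ i) : ℂ)‖ ^ 2 ≤ ∑ i, w i * M :=
        Finset.sum_le_sum fun i _ => mul_le_mul_of_nonneg_left (hp _ (hψ i)) (hw i)
    _ = M := by rw [← Finset.sum_mul, hsum, one_mul]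

variable (G : SimpleGraph V) [DecidableRel G.Adj]

/-- Flatness makes `2^(-S)` the largest eigenvalue of the reduced state. -/
lemma two_rpow_neg_entropy_reducedState (A : Finset V) :
    (2 : ℝ) ^ (-vonNeumannEntropy (reducedState G A)) = flatEigenvalue G A :=
  two_rpow_neg_vonNeumannEntropy (reducedState_isHermitian G A) (reducedState_mul_self G A)
    (reducedState_trace G A) (flatEigenvalue_pos G A)

lemma norm_inner_graphState_sq_le {A : Finset V} {ψ : Ket V} {Φ : Ket A}
    {Φ' : Ket (Aᶜ : Finset V)} (hψ : ∀ x, ψ x = Φ (restr A x) * Φ' (restr Aᶜ x))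
    (hn : ‖ψ‖ = 1) : ‖(inner ℂ (graphState G) ψ : ℂ)‖ ^ 2 ≤
      (2 : ℝ) ^ (-vonNeumannEntropy (reducedState G A)) := by
  have h := norm_inner_sq_le (reducedState_isHermitian G A) (reducedState_mul_self G A)
    (flatEigenvalue_pos G A) hψ
  rwa [hn, one_pow, mul_one, ← two_rpow_neg_entropy_reducedState] at h

end Overlap

/-! ### Separable pure states -/

section Separable

variable {V : Type*} [Fintype V] [DecidableEq V] {P : Finpartition (Finset.univ : Finset V)}

/-- Bit strings on all qubits as families of bit strings on the blocks of a partition. -/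
def restrEquiv (P : Finpartition (Finset.univ : Finset V)) :
    (V → Fin 2) ≃ ((B : P.parts) → (B.1 → Fin 2)) where
  toFun x B := restr B x
  invFun f v := f ⟨P.part v, P.part_mem.2 (Finset.mem_univ v)⟩ ⟨v, P.mem_part (Finset.mem_univ v)⟩
  left_inv x := rfl
  right_inv f := by
    funext ⟨B, hB⟩ ⟨v, hv⟩
    have key : ∀ (C : Finset V) (hC : C ∈ P.parts) (hvC : v ∈ C), C = B →
        f ⟨C, hC⟩ ⟨v, hvC⟩ = f ⟨B, hB⟩ ⟨v, hv⟩ := by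
      rintro C hC hvC rfl
      rfl
    exact key _ _ _ (P.part_eq_of_mem hB hv)

lemma IsFullySeparablePure.norm_eq_one {ψ : Ket V} (h : IsFullySeparablePure P ψ) : ‖ψ‖ = 1 := by
  obtain ⟨Φ, hΦ, hψ⟩ := h
  have hsq : ‖ψ‖ ^ 2 = 1 := by
    calc ‖ψ‖ ^ 2 = ∑ x, ∏ B : P.parts, ‖Φ B (restrEquiv P x B)‖ ^ 2 := by
          rw [EuclideanSpace.norm_sq_eq]
          refine Finset.sum_congr rfl fun x _ => ?_
          rw [hψ, norm_prod, ← Finset.prod_pow, ← Finset.prod_coe_sort]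
          rfl
      _ = ∏ B : P.parts, ∑ x, ‖Φ B x‖ ^ 2 := by
          rw [Fintype.prod_sum]
          exact (restrEquiv P).sum_comp
            (fun f : (B : P.parts) → (B.1 → Fin 2) => ∏ B : P.parts, ‖Φ B (f B)‖ ^ 2)
      _ = 1 := by
          refine Finset.prod_eq_one fun B _ => ?_
          rw [← EuclideanSpace.norm_sq_eq, hΦ B B.2, one_pow]
  exact (pow_eq_one_iff_of_nonneg (norm_nonneg ψ) two_ne_zero).mp hsq

/-- A fully separable pure state is a product across every bipartition. -/
lemma IsFullySeparablePure.exists_eq_mul {ψ : Ket V} (h : IsFullySeparablePure P ψ)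
    {A : Finset V} (hA : A ∈ bipartitions P) : ∃ (Φ : Ket A) (Φ' : Ket (Aᶜ : Finset V)),
      ∀ x, ψ x = Φ (restr A x) * Φ' (restr Aᶜ x) := by
  obtain ⟨Φ, -, hψ⟩ := h
  simp only [bipartitions, Finset.mem_filter, Finset.mem_image, Finset.mem_powerset] at hA
  obtain ⟨⟨Q, hQ, rfl⟩, -⟩ := hA
  set A := Q.sup id with hA
  refine ⟨WithLp.toLp 2 fun a => ∏ B ∈ Q, Φ B (restr B (glue A a 0)),
    WithLp.toLp 2 fun z => ∏ B ∈ P.parts \ Q, Φ B (restr B (glue A 0 z)), fun x => ?_⟩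
  rw [hψ, ← Finset.prod_sdiff hQ, mul_comm]
  congr 1
  · refine Finset.prod_congr rfl fun B hB => congrArg _ (funext fun v => ?_)
    have hv : (v : V) ∈ A := Finset.le_sup (f := id) hB v.2
    simp [restr, glue, hv]
  · refine Finset.prod_congr rfl fun B hB => congrArg _ (funext fun v => ?_)
    obtain ⟨hBP, hBQ⟩ := Finset.mem_sdiff.mp hB
    have hv : (v : V) ∉ A := by
      rw [hA, Finset.mem_sup]
      rintro ⟨C, hC, hvC⟩
      have hne : B ≠ C := fun e => hBQ (e ▸ hC)
      exact Finset.disjoint_left.mp (P.disjoint hBP (hQ hC) hne) v.2 hvC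
    simp [restr, glue, hv]

end Separable

end GraphStateFidelity

end

theorem proposition1 {V : Type*} [Fintype V] [DecidableEq V]
    (G : SimpleGraph V) [DecidableRel G.Adj]
    (P : Finpartition (Finset.univ : Finset V)) (hP : 2 ≤ P.parts.card) :
    (∀ ρ : GraphStateFidelity.Op V, GraphStateFidelity.IsFullySeparable P ρ →
      Matrix.trace (GraphStateFidelity.ketBra (GraphStateFidelity.graphState G) * ρ) ≤
        (((GraphStateFidelity.bipartitions P).inf'
          (GraphStateFidelity.bipartitions_nonempty P hP)
          (fun A => (2 : ℝ) ^ (-GraphStateFidelity.vonNeumannEntropy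
            (GraphStateFidelity.reducedState G A))) : ℝ) : ℂ)) ∧
    (∀ ρ : GraphStateFidelity.Op V, GraphStateFidelity.IsBiSeparable P ρ →
      Matrix.trace (GraphStateFidelity.ketBra (GraphStateFidelity.graphState G) * ρ) ≤
        (((GraphStateFidelity.bipartitions P).sup'
          (GraphStateFidelity.bipartitions_nonempty P hP)
          (fun A => (2 : ℝ) ^ (-GraphStateFidelity.vonNeumannEntropy
            (GraphStateFidelity.reducedState G A))) : ℝ) : ℂ)) := by
  refine ⟨fun ρ hρ => ?_, fun ρ hρ => ?_⟩
  · refine GraphStateFidelity.trace_ketBra_mul_le_of_isMixtureOf (fun ψ hψ => ?_) hρ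
    refine Finset.le_inf' _ _ fun A hA => ?_
    obtain ⟨Φ, Φ', h⟩ := hψ.exists_eq_mul hA
    exact GraphStateFidelity.norm_inner_graphState_sq_le G h hψ.norm_eq_one
  · refine GraphStateFidelity.trace_ketBra_mul_le_of_isMixtureOf (fun ψ hψ => ?_) hρ
    obtain ⟨A, hA, Φ, Φ', hΦ, hΦ', h⟩ := hψ
    have hn : ‖ψ‖ ^ 2 = 1 := by
      rw [GraphStateFidelity.norm_sq_of_eq_mul h, hΦ, hΦ']
      norm_num
    exact (GraphStateFidelity.norm_inner_graphState_sq_le G h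
      ((pow_eq_one_iff_of_nonneg (norm_nonneg ψ) two_ne_zero).mp hn)).trans
      (Finset.le_sup' (fun A => (2 : ℝ) ^ (-GraphStateFidelity.vonNeumannEntropy
        (GraphStateFidelity.reducedState G A))) hA)
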